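/- Let $X$ be a real reflexive Banach space with dual $X^*$ and duality pairing $\langle\cdot,\cdot\rangle$. A selfdual Lagrangian is a convex, lower semicontinuous function $L : X\times X^*\to\mathbb{R}\cup\{+\infty\}$ such that $L^*(u^*,u)=L(u,u^*)$ for all $(u,u^*)\in X\times X^*$, where $$L^*(u^*,u)=\sup\{\langle v,u^*\rangle+\langle u,v^*\rangle-L(v,v^*) : (v,v^*)\in X\times X^*\}.$$ Its selfdual vector field is $\overline{\partial}L(u)=\{u^*\in X^* : L(u,u^*)=\langle u,u^*\rangle\}$, with graph $\{(u,u^*) \in X\times X^*: u^*\in\overline{\partial}L(u)\}$. Let $L$ be a selfdual Lagrangian, let $\varepsilon\in\mathbb{R}$, and let $(u_0,u_0^*)\in X\times X^*$ satisfy $L(u_0,u_0^*)-\langle u_0,u_0^*\rangle\le\varepsilon$ (which forces $\varepsilon\ge 0$). Then there exists a pair $(u_\varepsilon,u_\varepsilon^*)$ in the graph of $\overline{\partial}L$ such that 1. $\|u_\varepsilon-u_0\|\le\sqrt{\varepsilon}$; 2. $\|u_\varepsilon^*-u_0^*\|\le\sqrt{\varepsilon}$, in the dual norm of $X^*$; 3.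 $|L(u_\varepsilon,u_\varepsilon^*)-L(u_0,u_0^*)|\le 2\varepsilon+\sqrt{\varepsilon}\,(\|u_0\|+\|u_0^*\|)$. -/

import Mathlib

/-- A real normed space is reflexive if the canonical isometric embedding into its
bidual is surjective. -/
def IsReflexiveSpace (X : Type*) [NormedAddCommGroup X] [NormedSpace ℝ X] : Prop :=
  Function.Surjective (NormedSpace.inclusionInDoubleDual ℝ X)

/-- The Fenchel-Legendre dual, in both variables, of a function `L` on the phase space
`X × X*`: `L*(u*, u) = sup {⟨v, u*⟩ + ⟨u, v*⟩ - L(v, v*) : (v, v*) ∈ X × X*}`. -/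
noncomputable def fenchelDual {X : Type*} [NormedAddCommGroup X] [NormedSpace ℝ X]
    (L : X × StrongDual ℝ X → EReal) (q : StrongDual ℝ X × X) : EReal :=
  ⨆ p : X × StrongDual ℝ X, (((q.1 p.1 + p.2 q.2 : ℝ) : EReal) - L p)

/-- `L : X × X* → ℝ ∪ {+∞}` is a selfdual Lagrangian: it is convex, lower semicontinuous
(for the norm topology), and `L*(u*, u) = L(u, u*)` for all `(u, u*) ∈ X × X*`. -/
structure IsSelfdualLagrangian {X : Type*} [NormedAddCommGroup X] [NormedSpace ℝ X]
    (L : X × StrongDual ℝ X → EReal) : Prop where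
  /-- `L` takes its values in `ℝ ∪ {+∞}`. -/
  ne_bot : ∀ p, L p ≠ ⊥
  convex : ∀ (p q : X × StrongDual ℝ X) (a b : ℝ), 0 ≤ a → 0 ≤ b → a + b = 1 →
    L (a • p + b • q) ≤ (a : EReal) * L p + (b : EReal) * L q
  lsc : LowerSemicontinuous L
  selfdual : ∀ (u : X) (u' : StrongDual ℝ X), fenchelDual L (u', u) = L (u, u')

/-- The (possibly multivalued) selfdual vector field `u ↦ {u* ∈ X* : L(u, u*) = ⟨u, u*⟩}`. -/
def selfdualField {X : Type*} [NormedAddCommGroup X] [NormedSpace ℝ X]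
    (L : X × StrongDual ℝ X → EReal) (u : X) : Set (StrongDual ℝ X) :=
  {u' | L (u, u') = ((u' u : ℝ) : EReal)}

/-- The graph in `X × X*` of the selfdual vector field of `L`. -/
def selfdualGraph {X : Type*} [NormedAddCommGroup X] [NormedSpace ℝ X]
    (L : X × StrongDual ℝ X → EReal) : Set (X × StrongDual ℝ X) :=
  {p | p.2 ∈ selfdualField L p.1}

section

variable {X : Type*} [NormedAddCommGroup X] [NormedSpace ℝ X]

/-! Selfduality gives `⟨u, u'⟩ ≤ L (u, u')`. Hence the function `‖v‖² / 2 + ‖v'‖² / 2` lies above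
the negative of `L` translated to `(u₀, u₀')`, with affine terms removed. Hahn-Banach separates the
two, and reflexivity turns the separating functional into a pair `(u, p)` in `X × X*`. Read through
selfduality, the separation bounds `L (u₀ - u, u₀' - p)` from above. Against the pairing bound from
below, this forces equality throughout: `‖p‖ = ‖u‖`, `⟨u, p⟩ = -‖u‖²`, and `(u₀ - u, u₀' - p)` is in
the graph. The Fenchel-Young inequality between this point and `(u₀, u₀')` then gives `‖u‖² ≤ ε`. -/

lemma half_sq_norm_le_of_forall_sub_half_sq_le (f : StrongDual ℝ X) {s : ℝ}
    (h : ∀ v, f v - ‖v‖ ^ 2 / 2 ≤ s) : ‖f‖ ^ 2 / 2 ≤ s := by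
  have hs : 0 ≤ s := by simpa using h 0
  have hf : ‖f‖ ≤ √(2 * s) := by
    refine f.opNorm_le_bound (Real.sqrt_nonneg _) fun v => ?_
    rw [Real.norm_eq_abs]
    refine abs_le_of_sq_le_sq ?_ (by positivity)
    rw [mul_pow, Real.sq_sqrt (by positivity)]
    rcases eq_or_ne v 0 with rfl | hv
    · simp
    have hv' : 0 < ‖v‖ ^ 2 := by positivity
    -- This multiple of `v` maximizes `f - ‖·‖² / 2` on the line `ℝ v`.
    have key := h ((f v / ‖v‖ ^ 2) • v)
    rw [map_smul, norm_smul, mul_pow, Real.norm_eq_abs, sq_abs, smul_eq_mul] at key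
    have e : f v / ‖v‖ ^ 2 * f v - (f v / ‖v‖ ^ 2) ^ 2 * ‖v‖ ^ 2 / 2
        = f v ^ 2 / (2 * ‖v‖ ^ 2) := by
      field_simp
      ring
    rw [e, div_le_iff₀ (by positivity)] at key
    linarith
  have := pow_le_pow_left₀ (norm_nonneg f) hf 2
  rw [Real.sq_sqrt (by positivity)] at this
  linarith

variable {L : X × StrongDual ℝ X → EReal}

/-- The Fenchel-Young inequality, with selfduality replacing the conjugate by `L`. Real upper bounds
`r` avoid `EReal` arithmetic. -/
lemma IsSelfdualLagrangian.add_sub_le (hL : IsSelfdualLagrangian L) {v : X}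
    {v' : StrongDual ℝ X} {r : ℝ} (hr : L (v, v') ≤ r) (u : X) (u' : StrongDual ℝ X) :
    ((u' v + v' u - r : ℝ) : EReal) ≤ L (u, u') := by
  rw [← hL.selfdual u u']
  refine le_trans ?_ (le_iSup _ (v, v'))
  rw [EReal.coe_sub]
  exact EReal.sub_le_sub le_rfl hr

lemma IsSelfdualLagrangian.le_of_forall (hL : IsSelfdualLagrangian L) {u : X}
    {u' : StrongDual ℝ X} {K : ℝ}
    (h : ∀ v v' (r : ℝ), L (v, v') ≤ r → u' v + v' u - r ≤ K) : L (u, u') ≤ K := by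
  rw [← hL.selfdual u u']
  refine iSup_le fun ⟨v, v'⟩ => ?_
  induction hr : L (v, v') using EReal.rec with
  | bot => exact absurd hr (hL.ne_bot _)
  | top => simp
  | coe r => exact_mod_cast h v v' r hr.le

/-- Fenchel-Young for a point paired with itself: `2⟨u, u'⟩ - r ≤ r`. -/
lemma IsSelfdualLagrangian.pairing_le_of_le (hL : IsSelfdualLagrangian L) {u : X}
    {u' : StrongDual ℝ X} {r : ℝ} (hr : L (u, u') ≤ r) : u' u ≤ r := by
  have := EReal.coe_le_coe_iff.1 ((hL.add_sub_le hr u u').trans hr)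
  linarith

lemma IsSelfdualLagrangian.convex_comb_le (hL : IsSelfdualLagrangian L)
    {p q : X × StrongDual ℝ X} {r s a b : ℝ} (hp : L p ≤ r) (hq : L q ≤ s)
    (ha : 0 ≤ a) (hb : 0 ≤ b) (hab : a + b = 1) :
    L (a • p + b • q) ≤ ((a * r + b * s : ℝ) : EReal) := by
  refine (hL.convex p q a b ha hb hab).trans ?_
  push_cast
  exact add_le_add (mul_le_mul_of_nonneg_left hp (by exact_mod_cast ha))
    (mul_le_mul_of_nonneg_left hq (by exact_mod_cast hb))

lemma neg_apply_le_norm_mul_norm (f : StrongDual ℝ X) (x : X) :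
    -(f x) ≤ ‖f‖ * ‖x‖ :=
  (neg_le_abs _).trans (f.le_opNorm x)

lemma convex_strict_epigraph_half_sq :
    Convex ℝ {z : (X × StrongDual ℝ X) × ℝ | ‖z.1.1‖ ^ 2 / 2 + ‖z.1.2‖ ^ 2 / 2 < z.2} := by
  have h1 : ConvexOn ℝ Set.univ fun z : X × StrongDual ℝ X => ‖z.1‖ ^ 2 :=
    (convexOn_univ_norm.comp_linearMap (LinearMap.fst ℝ X (StrongDual ℝ X))).pow
      (fun _ _ => norm_nonneg _) 2
  have h2 : ConvexOn ℝ Set.univ fun z : X × StrongDual ℝ X => ‖z.2‖ ^ 2 :=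
    (convexOn_univ_norm.comp_linearMap (LinearMap.snd ℝ X (StrongDual ℝ X))).pow
      (fun _ _ => norm_nonneg _) 2
  have h3 := ((h1.add h2).smul (by norm_num : (0 : ℝ) ≤ 1 / 2)).convex_strict_epigraph
  refine (congrArg (Convex ℝ) (Set.ext fun z => ?_)).mp h3
  change z.1 ∈ Set.univ ∧ (1 / 2 : ℝ) * (‖z.1.1‖ ^ 2 + ‖z.1.2‖ ^ 2) < z.2 ↔
    ‖z.1.1‖ ^ 2 / 2 + ‖z.1.2‖ ^ 2 / 2 < z.2
  rw [and_iff_right (Set.mem_univ _), mul_add, one_div_mul_eq_div, one_div_mul_eq_div]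

lemma IsSelfdualLagrangian.convex_translated_hypograph (hL : IsSelfdualLagrangian L) (u₀ : X)
    (u₀' : StrongDual ℝ X) :
    Convex ℝ {z : (X × StrongDual ℝ X) × ℝ | L (u₀ + z.1.1, u₀' + z.1.2) ≤
      ((u₀' z.1.1 + z.1.2 u₀ + u₀' u₀ - z.2 : ℝ) : EReal)} := by
  rintro ⟨⟨v, v'⟩, t⟩ hz ⟨⟨w, w'⟩, t'⟩ hw a b ha hb hab
  have key := hL.convex_comb_le hz hw ha hb hab
  have e1 : a • (u₀ + v, u₀' + v') + b • (u₀ + w, u₀' + w')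
      = (u₀ + (a • v + b • w), u₀' + (a • v' + b • w')) := by
    obtain rfl : b = 1 - a := by linarith
    ext1 <;> simp only [Prod.smul_mk, Prod.mk_add_mk] <;> module
  simp only [e1] at key
  simp only [Set.mem_ofPred_eq, Prod.smul_mk, Prod.mk_add_mk]
  convert key using 2
  obtain rfl : b = 1 - a := by linarith
  simp only [map_add, map_smul, add_apply, smul_apply, smul_eq_mul]
  ring

/-- In the second set the pairing bound at `(u₀ + v, u₀' + v')` reduces to `t ≤ -⟨v, v'⟩ ≤ ‖v‖
‖v'‖`, and by AM-GM this is at most `‖v‖² / 2 + ‖v'‖² / 2`. -/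
lemma IsSelfdualLagrangian.disjoint_strict_epigraph_translated_hypograph
    (hL : IsSelfdualLagrangian L) (u₀ : X) (u₀' : StrongDual ℝ X) :
    Disjoint {z : (X × StrongDual ℝ X) × ℝ | ‖z.1.1‖ ^ 2 / 2 + ‖z.1.2‖ ^ 2 / 2 < z.2}
      {z : (X × StrongDual ℝ X) × ℝ | L (u₀ + z.1.1, u₀' + z.1.2) ≤
      ((u₀' z.1.1 + z.1.2 u₀ + u₀' u₀ - z.2 : ℝ) : EReal)} := by
  rw [Set.disjoint_left]
  rintro ⟨⟨v, v'⟩, t⟩ (hA : _ < t) hB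
  have h1 := hL.pairing_le_of_le hB
  have h2 := neg_apply_le_norm_mul_norm v' v
  simp only [map_add, add_apply] at h1 hA
  nlinarith [sq_nonneg (‖v‖ - ‖v'‖)]

lemma exists_coordinates_of_dual_prod_prod {E F : Type*} [NormedAddCommGroup E] [NormedSpace ℝ E]
    [NormedAddCommGroup F] [NormedSpace ℝ F] (f : StrongDual ℝ ((E × F) × ℝ)) :
    ∃ (g : StrongDual ℝ E) (k : StrongDual ℝ F) (d : ℝ),
      ∀ v w t, f ((v, w), t) = g v + k w + d * t := by
  refine ⟨f.comp ((ContinuousLinearMap.inl ℝ (E × F) ℝ).comp (ContinuousLinearMap.inl ℝ E F)),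
    f.comp ((ContinuousLinearMap.inl ℝ (E × F) ℝ).comp (ContinuousLinearMap.inr ℝ E F)),
    f (0, 1), fun v w t => ?_⟩
  have : ((v, w), t) = ((v, (0 : F)), (0 : ℝ)) + (((0 : E), w), (0 : ℝ)) + t • (0, 1) := by
    simp
  rw [this, map_add, map_add, map_smul, smul_eq_mul, mul_comm]
  rfl

lemma exists_separating_coordinates {E F : Type*} [NormedAddCommGroup E] [NormedSpace ℝ E]
    [NormedAddCommGroup F] [NormedSpace ℝ F] {A B : Set ((E × F) × ℝ)} (hA : Convex ℝ A)
    (hAo : IsOpen A) (hB : Convex ℝ B) (hAB : Disjoint A B) :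
    ∃ (g : StrongDual ℝ E) (k : StrongDual ℝ F) (d c : ℝ),
      (∀ z ∈ A, g z.1.1 + k z.1.2 + d * z.2 < c) ∧
      ∀ z ∈ B, c ≤ g z.1.1 + k z.1.2 + d * z.2 := by
  obtain ⟨f, c, hfA, hfB⟩ := geometric_hahn_banach_open hA hAo hB hAB
  obtain ⟨g, k, d, hf⟩ := exists_coordinates_of_dual_prod_prod f
  exact ⟨g, k, d, c, fun z hz => (hf _ _ _).symm.trans_lt (hfA z hz),
    fun z hz => (hfB z hz).trans_eq (hf _ _ _)⟩

/-- Separation of the strict epigraph of `(v, v') ↦ ‖v‖² / 2 + ‖v'‖² / 2` from the hypograph of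
the negative of the translate of a selfdual Lagrangian to `(u₀, u₀')`, by a non-vertical
hyperplane. -/
lemma IsSelfdualLagrangian.exists_separating_hyperplane
    (hL : IsSelfdualLagrangian L) {u₀ : X} {u₀' : StrongDual ℝ X} {r₀ : ℝ}
    (h₀ : L (u₀, u₀') ≤ r₀) :
    ∃ (g : StrongDual ℝ X) (k : StrongDual ℝ (StrongDual ℝ X)) (c d : ℝ), d < 0 ∧
      (∀ v v' t, ‖v‖ ^ 2 / 2 + ‖v'‖ ^ 2 / 2 < t → g v + k v' + d * t < c) ∧
      ∀ v v' (r : ℝ), L (u₀ + v, u₀' + v') ≤ r →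
        c ≤ g v + k v' + d * (u₀' v + v' u₀ + u₀' u₀ - r) := by
  have hAo : IsOpen {z : (X × StrongDual ℝ X) × ℝ | ‖z.1.1‖ ^ 2 / 2 + ‖z.1.2‖ ^ 2 / 2 < z.2} :=
    isOpen_lt (by fun_prop) (by fun_prop)
  obtain ⟨g, k, d, c, hfA, hfB⟩ := exists_separating_coordinates
    convex_strict_epigraph_half_sq hAo (hL.convex_translated_hypograph u₀ u₀')
    (hL.disjoint_strict_epigraph_translated_hypograph u₀ u₀')
  have hA' : ∀ v v' t, ‖v‖ ^ 2 / 2 + ‖v'‖ ^ 2 / 2 < t → g v + k v' + d * t < c := by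
    intro v v' t ht
    exact hfA ((v, v'), t) ht
  have hB' : ∀ v v' (r : ℝ), L (u₀ + v, u₀' + v') ≤ r →
      c ≤ g v + k v' + d * (u₀' v + v' u₀ + u₀' u₀ - r) := by
    intro v v' r hr
    exact hfB ((v, v'), u₀' v + v' u₀ + u₀' u₀ - r) (by
      simpa only [Set.mem_ofPred_eq, sub_sub_cancel] using hr)
  have hdneg : d < 0 := by
    -- The maximum makes the last coordinate nonpositive, so `0 ≤ d` would give `c ≤ 0`, while the
    -- point `(0, 0, 1)` of the epigraph gives `d < c`.
    have h1 := hB' 0 0 (max r₀ (u₀' u₀)) (by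
      rw [add_zero, add_zero]
      exact h₀.trans (EReal.coe_le_coe_iff.2 (le_max_left _ _)))
    have h2 := hA' 0 0 1 (by simp)
    simp only [map_zero, zero_apply, zero_add] at h1 h2
    have h3 : u₀' u₀ - max r₀ (u₀' u₀) ≤ 0 := sub_nonpos.2 (le_max_right _ _)
    by_contra! hd0
    linarith [mul_nonpos_of_nonneg_of_nonpos hd0 h3]
  exact ⟨g, k, c, d, hdneg, hA', hB'⟩

/-- Fenchel duality for a selfdual Lagrangian translated to `(u₀, u₀')` against the function
`(v, v') ↦ ‖v‖² / 2 + ‖v'‖² / 2`, with the dual maximizer represented by reflexivity. -/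
lemma IsSelfdualLagrangian.exists_dual_maximizer (hX : IsReflexiveSpace X)
    (hL : IsSelfdualLagrangian L) {u₀ : X} {u₀' : StrongDual ℝ X} {r₀ : ℝ}
    (h₀ : L (u₀, u₀') ≤ r₀) :
    ∃ (u : X) (p : StrongDual ℝ X) (s : ℝ),
      ‖p‖ ^ 2 / 2 + ‖u‖ ^ 2 / 2 ≤ s ∧
      ∀ v v' (r : ℝ), L (u₀ + v, u₀' + v') ≤ r →
        s ≤ p v + v' u - (u₀' v + v' u₀ + u₀' u₀ - r) := by
  obtain ⟨g, k, c, d, hdneg, hA', hB'⟩ := hL.exists_separating_hyperplane h₀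
  obtain ⟨u, hu⟩ := hX ((-d)⁻¹ • k)
  have hu' : ∀ v' : StrongDual ℝ X, v' u = (-d)⁻¹ * k v' := fun v' => by
    rw [← NormedSpace.dual_def ℝ X u v', hu]
    rfl
  have hi : 0 < (-d)⁻¹ := inv_pos.2 (neg_pos.2 hdneg)
  have hid : (-d)⁻¹ * d = -1 := by
    rw [inv_neg, neg_mul, inv_mul_cancel₀ hdneg.ne]
  refine ⟨u, (-d)⁻¹ • g, (-d)⁻¹ * c, ?_, fun v v' r hr => ?_⟩
  · have hbd : ∀ v v', ((-d)⁻¹ • g) v + ((-d)⁻¹ • k) v' - ‖v‖ ^ 2 / 2 - ‖v'‖ ^ 2 / 2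
        ≤ (-d)⁻¹ * c := by
      intro v v'
      refine le_of_forall_pos_le_add fun δ hδ => ?_
      have h1 := hA' v v' (‖v‖ ^ 2 / 2 + ‖v'‖ ^ 2 / 2 + δ) (by linarith)
      have h2 := mul_le_mul_of_nonneg_left h1.le hi.le
      simp only [smul_apply, smul_eq_mul]
      linear_combination h2 - (‖v‖ ^ 2 / 2 + ‖v'‖ ^ 2 / 2 + δ) * hid
    -- The half square of the norm is conjugate to that of the dual norm; the supremum is taken over
    -- `v` first, then over `v'`.
    have h1 : ∀ v', ‖(-d)⁻¹ • g‖ ^ 2 / 2 ≤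
        (-d)⁻¹ * c - ((-d)⁻¹ • k) v' + ‖v'‖ ^ 2 / 2 := fun v' =>
      half_sq_norm_le_of_forall_sub_half_sq_le _ fun v => by linarith [hbd v v']
    have h2 := half_sq_norm_le_of_forall_sub_half_sq_le ((-d)⁻¹ • k)
      (s := (-d)⁻¹ * c - ‖(-d)⁻¹ • g‖ ^ 2 / 2) fun v' => by linarith [h1 v']
    have h3 : ‖(-d)⁻¹ • k‖ = ‖u‖ := by
      rw [← hu]
      exact (NormedSpace.inclusionInDoubleDualLi ℝ (E := X)).norm_map u
    rw [h3] at h2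
    linarith
  · have h1 := mul_le_mul_of_nonneg_left (hB' v v' r hr) hi.le
    rw [hu', smul_apply, smul_eq_mul]
    linear_combination h1 + (u₀' v + v' u₀ + u₀' u₀ - r) * hid

end

theorem lemma2p2 {X : Type*} [NormedAddCommGroup X] [NormedSpace ℝ X] [CompleteSpace X]
    (hX : IsReflexiveSpace X) (L : X × StrongDual ℝ X → EReal)
    (hL : IsSelfdualLagrangian L) (u₀ : X) (u₀' : StrongDual ℝ X) (ε : ℝ)
    (h : L (u₀, u₀') - ((u₀' u₀ : ℝ) : EReal) ≤ (ε : EReal)) :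
    ∃ (uε : X) (uε' : StrongDual ℝ X), (uε, uε') ∈ selfdualGraph L ∧
      ‖uε - u₀‖ ≤ Real.sqrt ε ∧
      ‖uε' - u₀'‖ ≤ Real.sqrt ε ∧
      (L (uε, uε') - L (u₀, u₀')).abs ≤
        ENNReal.ofReal (2 * ε + Real.sqrt ε * (‖u₀‖ + ‖u₀'‖)) := by
  obtain ⟨r₀, hr₀⟩ : ∃ r₀ : ℝ, L (u₀, u₀') = r₀ := by
    induction hr : L (u₀, u₀') using EReal.rec with
    | bot => exact absurd hr (hL.ne_bot _)
    | top => simp [hr] at h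
    | coe r => exact ⟨r, rfl⟩
  have hε : r₀ - u₀' u₀ ≤ ε := by
    rw [hr₀] at h
    exact_mod_cast h
  have hlow := hL.pairing_le_of_le hr₀.le
  obtain ⟨u, p, s, hs, hB⟩ := hL.exists_dual_maximizer hX hr₀.le
  have hle : L (u₀ - u, u₀' - p) ≤ ((u₀' u₀ - p u₀ - u₀' u - s : ℝ) : EReal) := by
    refine hL.le_of_forall fun v v' r hr => ?_
    have := hB (v - u₀) (v' - u₀') r (by simpa using hr)
    simp only [map_sub, sub_apply] at this ⊢
    linarith
  have hpair := hL.pairing_le_of_le hle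
  have hpu := neg_apply_le_norm_mul_norm p u
  simp only [map_sub, sub_apply] at hpair
  -- The chain `‖p‖² / 2 + ‖u‖² / 2 ≤ s ≤ -⟨u, p⟩ ≤ ‖p‖ ‖u‖` collapses to equalities.
  have hnorm : ‖p‖ = ‖u‖ := by
    have : (‖p‖ - ‖u‖) ^ 2 ≤ 0 := by linarith
    exact sub_eq_zero.1 (pow_eq_zero_iff two_ne_zero |>.1 (le_antisymm this (sq_nonneg _)))
  rw [hnorm] at hs hpu
  have hval : p u = -‖u‖ ^ 2 := by linarith
  have heq : L (u₀ - u, u₀' - p) = (((u₀' - p) (u₀ - u) : ℝ) : EReal) := by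
    have hle' : L (u₀ - u, u₀' - p) ≤ (((u₀' - p) (u₀ - u) : ℝ) : EReal) := by
      refine hle.trans (EReal.coe_le_coe_iff.2 ?_)
      simp only [map_sub, sub_apply]
      linarith
    refine le_antisymm hle' (le_trans (EReal.coe_le_coe_iff.2 ?_) (hL.add_sub_le hle' _ _))
    linarith
  have hu : ‖u‖ ^ 2 ≤ ε := by
    have := hL.add_sub_le hr₀.le (u₀ - u) (u₀' - p)
    rw [heq, EReal.coe_le_coe_iff] at this
    simp only [map_sub, sub_apply] at this
    linarith
  have hu' : ‖u‖ ≤ √ε := Real.le_sqrt_of_sq_le hu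
  refine ⟨u₀ - u, u₀' - p, heq, by simpa using hu', by simpa [hnorm] using hu', ?_⟩
  rw [heq, hr₀, ← EReal.coe_sub, EReal.abs_def]
  refine ENNReal.ofReal_le_ofReal ?_
  have h1 : |p u₀| ≤ √ε * ‖u₀‖ := (p.le_opNorm u₀).trans (by rw [hnorm]; gcongr)
  have h2 : |u₀' u| ≤ √ε * ‖u₀'‖ := (u₀'.le_opNorm u).trans (by rw [mul_comm]; gcongr)
  rw [abs_le] at h1 h2 ⊢
  simp only [map_sub, sub_apply]
  -- The difference of values is `(⟨u₀, u₀'⟩ - r₀) - p u₀ - u₀' u - ‖u‖²`; its first and last terms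
  -- are each at most `ε` in absolute value, whence `2 * ε`.
  constructor <;> nlinarith [sq_nonneg ‖u‖]
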